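/- Let $\mathbf a_1,\dots,\mathbf a_N\in\mathbb Z^n$ and let $L=\{l\in\mathbb Z^N : \sum_{i=1}^N l_i\mathbf a_i=\mathbf 0\}$. Let $v=(v_1,\dots,v_N)\in\mathbb Q^N$ with $-1\le v_i\le 0$ for all $i$. For $u\in\mathbb Q^N$ let $\operatorname{nsupp}(u)$ be the set of indices $i$ such that $u_i$ is a negative integer, and put $$L_v=\{l\in L : \operatorname{nsupp}(v+l)=\operatorname{nsupp}(v)\},\qquad \Phi_v(\lambda)=\sum_{l\in L_v}[v]_l\,\lambda^{v+l},\qquad [v]_l=\prod_{i=1}^N[v_i]_{l_i},$$ where, for $r\in\mathbb Q$ and $k\in\mathbb Z$, $$[r]_k=\begin{cases}1 & k=0,\\ \dfrac{1}{(r+1)(r+2)\cdots(r+k)} & k>0,\\ r(r-1)\cdots(r+k+1) & k<0.\end{cases}$$ Suppose that $L_v$ lies in a convex cone $C\subseteq\mathbb R^N$ that is pointed with vertex at the origin, i.e. $C\cap(-C)=\{0\}$, and that the formal series $\Phi_v(\lambda)$ is algebraic over $\mathbb Q(\lambda)=\mathbb Q(\lambda_1,\dots,\lambda_N)$, i.e.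 there is a nonzero polynomial $\sum_k q_k(\lambda)Y^k$ with coefficients $q_k\in\mathbb Q[\lambda_1,\dots,\lambda_N]$ such that $\sum_k q_k(\lambda)\Phi_v(\lambda)^k=0$. Then, for every prime $p$ such that all $v_i$ are $p$-integral (i.e. have denominator prime to $p$), all coefficients $[v]_l$, $l\in L_v$, of $\Phi_v(\lambda)$ are $p$-integral. -/

import Mathlib

namespace AHypergeometric

/-- The lattice `L` of integer relations `∑ lᵢ aᵢ = 0` on the vectors `a₁, …, a_N ∈ ℤⁿ`. -/
def relationLattice {n N : ℕ} (a : Fin N → Fin n → ℤ) : Set (Fin N → ℤ) :=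
  {l | ∑ i, l i • a i = 0}

/-- The negative support: the set of indices `i` such that `vᵢ` is a negative integer. -/
def nsupp {N : ℕ} (v : Fin N → ℚ) : Set (Fin N) :=
  {i | ∃ m : ℤ, m < 0 ∧ v i = m}

/-- The exponent `v + l`. -/
def shift {N : ℕ} (v : Fin N → ℚ) (l : Fin N → ℤ) : Fin N → ℚ :=
  fun i => v i + l i

/-- `L_v`: the relations `l` such that `v + l` and `v` have the same negative support. -/
def Lv {n N : ℕ} (a : Fin N → Fin n → ℤ) (v : Fin N → ℚ) : Set (Fin N → ℤ) :=
  {l | l ∈ relationLattice a ∧ nsupp (shift v l) = nsupp v}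

/-- The scalar symbol `[r]_k`: it is `1 / ((r + 1) ⋯ (r + k))` for `k ≥ 0` (so `1` for `k = 0`),
and `r (r - 1) ⋯ (r + k + 1)` for `k < 0`. -/
def bracket (r : ℚ) : ℤ → ℚ
  | Int.ofNat k => 1 / ∏ j ∈ Finset.range k, (r + ((j : ℚ) + 1))
  | Int.negSucc k => ∏ j ∈ Finset.range (k + 1), (r - (j : ℚ))

/-- The vector symbol `[v]_l = ∏ [vᵢ]_{lᵢ}`. -/
def vbracket {N : ℕ} (v : Fin N → ℚ) (l : Fin N → ℤ) : ℚ :=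
  ∏ i, bracket (v i) (l i)

/-- A formal series `∑ c_w λ^w` in `λ₁, …, λ_N` with exponents `w ∈ ℚᴺ` and coefficients
`c_w ∈ ℚ`, given by its coefficient function `w ↦ c_w`. -/
abbrev Series (N : ℕ) : Type := (Fin N → ℚ) → ℚ

/-- The hypergeometric series `Φ_v(λ) = ∑_{l ∈ L_v} [v]_l λ^{v+l}`: the coefficient of
`λ^{v+l}` is `[v]_l` for `l ∈ L_v` (the map `l ↦ v + l` is injective), and all other coefficients
vanish. -/
noncomputable def Phi {n N : ℕ} (a : Fin N → Fin n → ℤ) (v : Fin N → ℚ) : Series N :=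
  Function.extend (fun l : Lv a v => shift v l.1) (fun l : Lv a v => vbracket v l.1) 0

namespace Series

/-- The monomial `λ⁰ = 1`. -/
noncomputable def one (N : ℕ) : Series N := Pi.single 0 1

/-- The product of formal series (Cauchy product). It is meaningful when every exponent is in only
finitely many ways a sum of an exponent of `f` and an exponent of `g`, as it is for polynomials and
for series whose exponents lie in translates of the set of integer points of one closed pointed
cone. -/
noncomputable def mul {N : ℕ} (f g : Series N) : Series N :=
  fun w => ∑ᶠ u : Fin N → ℚ, f u * g (w - u)

/-- The powers of a formal series. -/
noncomputable def pow {N : ℕ} (f : Series N) : ℕ → Series N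
  | 0 => one N
  | k + 1 => mul (pow f k) f

/-- A polynomial in `λ₁, …, λ_N` as a formal series. -/
noncomputable def ofPolynomial {N : ℕ} (q : MvPolynomial (Fin N) ℚ) : Series N :=
  Function.extend (fun (d : Fin N →₀ ℕ) (i : Fin N) => ((d i : ℕ) : ℚ))
    (fun d => q.coeff d) 0

/-- `f` is algebraic over `ℚ(λ₁, …, λ_N)`: it satisfies `∑ₖ qₖ(λ) f^k = 0` for some polynomial
`∑ₖ qₖ Y^k ≠ 0` in `Y`, whose coefficients may be taken in `ℚ[λ₁, …, λ_N]` after clearing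
denominators. -/
def IsAlgebraicOverRatFunc {N : ℕ} (f : Series N) : Prop :=
  ∃ P : Polynomial (MvPolynomial (Fin N) ℚ), P ≠ 0 ∧
    ∑ k ∈ P.support, mul (ofPolynomial (P.coeff k)) (pow f k) = 0

end Series

/-- A rational number is `p`-integral if `p` does not divide its denominator. -/
def IsPIntegral (p : ℕ) (q : ℚ) : Prop := ¬ p ∣ q.den

/-- All coefficients of the series are `p`-integral. -/
def Series.HasPIntegralCoeffs {N : ℕ} (p : ℕ) (f : Series N) : Prop :=
  ∀ w, IsPIntegral p (f w)

/-- The set `S ⊆ ℤᴺ` lies in a pointed convex cone in `ℝᴺ` with vertex at the origin, that is, in a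
convex cone containing no line through the origin. -/
def LiesInPointedCone {N : ℕ} (S : Set (Fin N → ℤ)) : Prop :=
  ∃ C : ConvexCone ℝ (Fin N → ℝ), C.Pointed ∧ C.Salient ∧
    ∀ l ∈ S, (fun i => ((l i : ℤ) : ℝ)) ∈ C

end AHypergeometric

/-!
The proof compares the coefficients of `Φ_v` at `p` with those at infinitely many other primes.

*Almost all primes.* For `-1 ≤ vᵢ ≤ 0`, the set `L_v` is cut out of `L` by the conditions `lᵢ ≥ 0`
where `vᵢ = 0` and `lᵢ ≤ 0` where `vᵢ = -1`. As `L_v` contains no line, an element of `L` is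
determined by these coordinates. So `Φ_v` has finitely many terms in each degree for the grading
`degree v`, and becomes a power series in one variable over the domain `ℚ[ℚᴺ]`, the group algebra
of the exponents (`IsExpansion`). This power series is algebraic, so by Eisenstein's theorem
(`PowerSeries.exists_finset_mem_of_eval_eq_zero`) its coefficients are obtained from finitely many
elements of `ℚ[ℚᴺ]` by ring operations and division by one element `c`. For almost all primes `q`
the finitely many elements have `q`-integral coefficients and `c` has Gauss norm `1`, and then
Gauss's lemma (`AddMonoidAlgebra.mem_gaussSubring_of_mul_mem`) makes all coefficients of `Φ_v`
`q`-integral.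

*Transfer between primes.* Write `vᵢ = -mᵢ / D` with `D` prime to `p`, and let
`ρ_{s,i} ∈ [0, p ^ s)` be congruent to `vᵢ` modulo `p ^ s`. An analogue of Legendre's formula
(`padicValRat_vbracket`) says that the valuation of `[v]_l` is
`-∑ₛ ∑ᵢ ⌊(lᵢ + ρ_{s,i}) / p ^ s⌋`. If it is negative, then for some `P = p ^ s` the sum over `i` is
positive. Now `ρ_{s,i} = (P mᵢ' - mᵢ) / D` where `mᵢ'` depends only on `P` modulo `D`, so for a
large prime `q` congruent to `P` modulo `D` (Dirichlet) the residue modulo `q` is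
`(q mᵢ' - mᵢ) / D`. With `k = ⌈q / P⌉`, the vector `k l / q` is a slight dilation of `l / P`, and
all floors are unchanged: at indices with `vᵢ ∈ {0, -1}` the sign condition makes the dilation
harmless, and at the others the numerators `mᵢ`, with `0 < mᵢ < D`, leave a margin to the next
integers. The terms at higher powers of `q` vanish as `k l` is small against `q ^ 2`. So `[v]_{k l}`
is not `q`-integral for infinitely many primes `q` (`exists_not_isPIntegral`), which contradicts
the first part.
-/

/-! ### Eisenstein's theorem for power series over a domain -/

namespace PowerSeries

open Polynomial (taylor)

variable {A : Type*} [CommRing A]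

/-- The power series with coefficients in a subring, as a subring of all power series. -/
def coeffSubring (S : Subring A) : Subring A⟦X⟧ where
  carrier := {f | ∀ n, coeff n f ∈ S}
  zero_mem' n := by simp [S.zero_mem]
  one_mem' n := by
    rw [coeff_one]
    split_ifs
    exacts [S.one_mem, S.zero_mem]
  add_mem' hf hg n := by simpa using S.add_mem (hf n) (hg n)
  neg_mem' hf n := by simpa using S.neg_mem (hf n)
  mul_mem' hf hg n := by
    rw [coeff_mul]
    exact S.sum_mem fun _ _ => S.mul_mem (hf _) (hg _)

theorem X_mem_coeffSubring (S : Subring A) : (X : A⟦X⟧) ∈ coeffSubring S := fun n => by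
  rw [coeff_X]
  split_ifs
  exacts [S.one_mem, S.zero_mem]

theorem trunc_mem_coeffSubring {S : Subring A} {f : A⟦X⟧} {n : ℕ}
    (h : ∀ m < n, coeff m f ∈ S) : (trunc n f : A⟦X⟧) ∈ coeffSubring S := fun m => by
  rw [Polynomial.coeff_coe, coeff_trunc]
  split_ifs with hm
  exacts [h m hm, S.zero_mem]

theorem mem_coeffSubring_of_X_pow_mul_mem {S : Subring A} {f : A⟦X⟧} {n : ℕ}
    (h : X ^ n * f ∈ coeffSubring S) : f ∈ coeffSubring S := fun m => by
  have := h (m + n)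
  rwa [coeff_X_pow_mul] at this

theorem X_pow_dvd_sub_trunc (n : ℕ) (f : A⟦X⟧) : X ^ n ∣ f - (trunc n f : A⟦X⟧) := by
  refine X_pow_dvd_iff.2 fun m hm => ?_
  rw [map_sub, Polynomial.coeff_coe, coeff_trunc, if_pos hm, sub_self]

theorem _root_.Polynomial.eval_mem_of_coeff_mem {R : Type*} [CommRing R] {W : Subring R}
    {P : Polynomial R} (hP : ∀ k, P.coeff k ∈ W) {x : R} (hx : x ∈ W) : P.eval x ∈ W := by
  rw [Polynomial.eval_eq_sum, Polynomial.sum]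
  exact W.sum_mem fun k _ => W.mul_mem (hP k) (W.pow_mem hx k)

theorem _root_.Polynomial.taylor_coeff_mem {R : Type*} [CommRing R] {W : Subring R}
    {P : Polynomial R} (hP : ∀ k, P.coeff k ∈ W) {x : R} (hx : x ∈ W) (n : ℕ) :
    (taylor x P).coeff n ∈ W := by
  rw [Polynomial.taylor_coeff]
  refine Polynomial.eval_mem_of_coeff_mem (fun k => ?_) hx
  rw [Polynomial.hasseDeriv_coeff]
  exact W.mul_mem (natCast_mem W _) (hP _)

/-- A contraction principle: if `c g = b + t H(g)`, then the `n`-th coefficient of `c g` is a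
polynomial expression in the earlier coefficients of `g`. -/
theorem mem_coeffSubring_of_fixedPoint {S : Subring A} {c : A}
    (hc : ∀ x, c * x ∈ S → x ∈ S) {b g : A⟦X⟧} (hb : b ∈ coeffSubring S)
    {H : Polynomial A⟦X⟧} (hH : ∀ k, H.coeff k ∈ coeffSubring S)
    (h : C c * g = b + X * H.eval g) : g ∈ coeffSubring S := by
  intro n
  induction n using Nat.strong_induction_on with
  | _ n ih =>
    apply hc
    rw [← coeff_C_mul, h, map_add]
    refine S.add_mem (hb n) ?_
    cases n with
    | zero => simp [S.zero_mem]
    | succ m =>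
      rw [coeff_succ_X_mul]
      have hdvd : X ^ (m + 1) ∣ H.eval g - H.eval (trunc (m + 1) g : A⟦X⟧) :=
        (X_pow_dvd_sub_trunc _ _).trans (Polynomial.sub_dvd_eval_sub _ _ _)
      have hm := X_pow_dvd_iff.1 hdvd m m.lt_succ_self
      rw [map_sub, sub_eq_zero] at hm
      rw [hm]
      exact Polynomial.eval_mem_of_coeff_mem hH (trunc_mem_coeffSubring ih) m

/-- The case of a simple root in the theorem below. With `e` the order of `P'(f)` and `f₀` the
truncation of `f` modulo `t ^ (e + 1)`, the substitution `f = f₀ + t ^ (e + 1) g` turns `P(f) = 0`,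
after division by `t ^ (2 e + 1)`, into a fixed point equation for `g`. -/
theorem exists_finset_mem_of_derivative_ne_zero [IsDomain A] {f : A⟦X⟧} {P : Polynomial A⟦X⟧}
    (hf : P.eval f = 0) (hd : P.derivative.eval f ≠ 0) :
    ∃ (T : Finset A) (c : A), c ≠ 0 ∧ ∀ S : Subring A,
      (∀ k, P.coeff k ∈ coeffSubring S) → (∀ x ∈ T, x ∈ S) → (∀ x, c * x ∈ S → x ∈ S) →
      f ∈ coeffSubring S := by
  classical
  set e := (P.derivative.eval f).order.toNat with he
  refine ⟨(Finset.range (e + 1)).image fun n => coeff n f, coeff e (P.derivative.eval f),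
    coeff_order hd, fun S hP hT hc => ?_⟩
  set f₀ : A⟦X⟧ := (trunc (e + 1) f : A⟦X⟧) with hf₀
  have hf₀S : f₀ ∈ coeffSubring S := trunc_mem_coeffSubring fun m hm =>
    hT _ (Finset.mem_image_of_mem _ (Finset.mem_range.2 hm))
  obtain ⟨g, hg⟩ : X ^ (e + 1) ∣ f - f₀ := X_pow_dvd_sub_trunc _ _
  have hB := Polynomial.taylor_coeff_mem hP hf₀S
  set Q := taylor f₀ P with hQ
  set R := Q.divX.divX with hR
  have hRS : ∀ k, R.coeff k ∈ coeffSubring S := fun k => by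
    rw [hR, Polynomial.coeff_divX, Polynomial.coeff_divX]
    exact hB _
  -- `P'(f₀)` agrees with `P'(f)` modulo `t ^ (e + 1)`, so it is `t ^ e (c + t u)`
  have hcoeff : ∀ n ≤ e, coeff n (Q.coeff 1) = coeff n (P.derivative.eval f) := fun n hn => by
    have h1 : X ^ (e + 1) ∣ P.derivative.eval f - P.derivative.eval f₀ :=
      (X_pow_dvd_sub_trunc _ _).trans (Polynomial.sub_dvd_eval_sub _ _ _)
    have h2 := X_pow_dvd_iff.1 h1 n (by omega)
    rw [map_sub, sub_eq_zero] at h2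
    rw [hQ, Polynomial.taylor_coeff_one, h2]
  set c := coeff e (P.derivative.eval f) with hc'
  obtain ⟨d, hd⟩ : X ^ e ∣ Q.coeff 1 := X_pow_dvd_iff.2 fun n hn => by
    rw [hcoeff n hn.le]
    exact coeff_of_lt_order_toNat n hn
  have hdS : d ∈ coeffSubring S := mem_coeffSubring_of_X_pow_mul_mem (hd ▸ hB 1)
  have hd0 : constantCoeff d = c := by
    rw [hc', ← hcoeff e le_rfl, hd, coeff_X_pow_mul', if_pos le_rfl, Nat.sub_self,
      coeff_zero_eq_constantCoeff_apply]
  obtain ⟨u, hu⟩ : X ∣ d - C c := by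
    rw [X_dvd_iff, map_sub, hd0, constantCoeff_C, sub_self]
  have huS : u ∈ coeffSubring S := by
    refine mem_coeffSubring_of_X_pow_mul_mem (n := 1) ?_
    rw [pow_one, ← hu]
    refine Subring.sub_mem _ hdS fun n => ?_
    rw [coeff_C]
    split_ifs
    · rw [← hd0, ← coeff_zero_eq_constantCoeff_apply]
      exact hdS 0
    · exact S.zero_mem
  have hQg : Q.coeff 0 + Q.coeff 1 * (X ^ (e + 1) * g)
      + (X ^ (e + 1) * g) ^ 2 * R.eval (X ^ (e + 1) * g) = 0 := by
    have h1 : Q.eval (X ^ (e + 1) * g) = 0 := by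
      rw [hQ, Polynomial.taylor_eval, ← hg, sub_add_cancel, hf]
    have h2 := Polynomial.divX_mul_X_add Q
    have h3 := Polynomial.divX_mul_X_add Q.divX
    rw [← h2, ← h3] at h1
    simp only [Polynomial.eval_add, Polynomial.eval_mul, Polynomial.eval_X, Polynomial.eval_C,
      Polynomial.coeff_divX, zero_add, ← hR] at h1
    linear_combination h1
  -- hence `P(f₀)` is divisible by `t ^ (2 e + 1)`
  obtain ⟨b, hb⟩ : X ^ (2 * e + 1) ∣ Q.coeff 0 :=
    ⟨-(d * g + X * (g ^ 2 * R.eval (X ^ (e + 1) * g))), by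
      rw [hd] at hQg
      linear_combination hQg⟩
  have hbS : b ∈ coeffSubring S := mem_coeffSubring_of_X_pow_mul_mem (hb ▸ hB 0)
  have hkey : b + (C c + X * u) * g + X * (g ^ 2 * R.eval (X ^ (e + 1) * g)) = 0 := by
    have hX : (X : A⟦X⟧) ^ (2 * e + 1) ≠ 0 := pow_ne_zero _ X_ne_zero
    refine (mul_eq_zero.1 ?_).resolve_left hX
    rw [hb, hd] at hQg
    linear_combination hQg - X ^ (2 * e + 1) * g * hu
  have hgS : g ∈ coeffSubring S := by
    refine mem_coeffSubring_of_fixedPoint hc (b := -b) (Subring.neg_mem _ hbS)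
      (H := -(Polynomial.C u * Polynomial.X
        + Polynomial.X ^ 2 * R.comp (Polynomial.C (X ^ (e + 1)) * Polynomial.X))) (fun k => ?_) ?_
    · have hXS := Subring.pow_mem _ (X_mem_coeffSubring S) (e + 1)
      rw [Polynomial.coeff_neg, Polynomial.coeff_add, Polynomial.coeff_C_mul_X,
        Polynomial.coeff_X_pow_mul', Polynomial.comp_C_mul_X_coeff]
      refine Subring.neg_mem _ (Subring.add_mem _ ?_ ?_) <;> split_ifs
      exacts [huS, Subring.zero_mem _, Subring.mul_mem _ (hRS _) (Subring.pow_mem _ hXS _),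
        Subring.zero_mem _]
    · simp only [Polynomial.eval_neg, Polynomial.eval_add, Polynomial.eval_mul,
        Polynomial.eval_C, Polynomial.eval_X, Polynomial.eval_pow, Polynomial.eval_comp]
      linear_combination hkey
  rw [← sub_add_cancel f f₀, hg]
  exact Subring.add_mem _
    (Subring.mul_mem _ (Subring.pow_mem _ (X_mem_coeffSubring S) _) hgS) hf₀S

/-- Eisenstein's theorem: the coefficients of an algebraic power series lie in a ring obtained from
the coefficients of its equation by adjoining finitely many elements and inverting one element.
To avoid fractions, the latter is phrased through subrings `S` in which division by `c` is
possible whenever it is possible in `A`. -/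
theorem exists_finset_mem_of_eval_eq_zero [IsDomain A] [CharZero A] {f : A⟦X⟧}
    {P : Polynomial A⟦X⟧} (hP : P ≠ 0) (hf : P.eval f = 0) :
    ∃ (T : Finset A) (c : A), c ≠ 0 ∧ ∀ S : Subring A,
      (∀ k, P.coeff k ∈ coeffSubring S) → (∀ x ∈ T, x ∈ S) → (∀ x, c * x ∈ S → x ∈ S) →
      f ∈ coeffSubring S := by
  have : CharZero A⟦X⟧ := charZero_of_injective_ringHom (C_injective (R := A))
  induction hn : P.natDegree using Nat.strong_induction_on generalizing P with
  | _ n ih =>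
    by_cases hd : P.derivative.eval f = 0
    · have hn0 : P.natDegree ≠ 0 := fun h0 => by
        rw [Polynomial.eq_C_of_natDegree_eq_zero h0, Polynomial.eval_C] at hf
        exact hP (by rw [Polynomial.eq_C_of_natDegree_eq_zero h0, hf, Polynomial.C_0])
      have hd0 : P.derivative ≠ 0 := fun h0 =>
        hn0 (Polynomial.derivative_eq_zero.1 h0)
      obtain ⟨T, c, hc0, h⟩ :=
        ih _ (hn ▸ Polynomial.natDegree_derivative_lt hn0) hd0 hd rfl
      refine ⟨T, c, hc0, fun S hS hT hc => h S (fun k => ?_) hT hc⟩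
      rw [Polynomial.coeff_derivative]
      exact Subring.mul_mem _ (hS _) (Subring.add_mem _ (natCast_mem _ k) (Subring.one_mem _))
    · exact exists_finset_mem_of_derivative_ne_zero hf hd

end PowerSeries

/-! ### Gauss's lemma for group algebras -/

namespace AddMonoidAlgebra

variable {K Γ G : Type*} [Field K] [LinearOrderedCommGroupWithZero Γ] [AddCommGroup G]

/-- The elements of a group algebra all of whose coefficients are integral for a valuation, that
is, the unit ball of the Gauss norm. -/
def gaussSubring (G : Type*) [AddCommGroup G] (ν : Valuation K Γ) :
    Subring (AddMonoidAlgebra K G) where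
  carrier := {x | ∀ g, ν (x.coeff g) ≤ 1}
  zero_mem' g := by simp
  one_mem' g := by
    classical
    rw [one_def, coeff_single, Finsupp.single_apply]
    split_ifs <;> simp
  add_mem' hx hy g := (ν.map_add _ _).trans (max_le (hx g) (hy g))
  neg_mem' hx g := by simpa using hx g
  mul_mem' {x y} hx hy g := by
    classical
    rw [coeff_mul]
    refine ν.map_sum_le fun a _ => ν.map_sum_le fun b _ => ?_
    dsimp only
    split_ifs
    · rw [map_mul]
      exact mul_le_one' (hx a) (hy b)
    · simp

theorem mem_gaussSubring {ν : Valuation K Γ} {x : AddMonoidAlgebra K G} :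
    x ∈ gaussSubring G ν ↔ ∀ g, ν (x.coeff g) ≤ 1 := Iff.rfl

/-- Gauss's lemma: an element of Gauss norm `1` can be cancelled. Among the products of
a coefficient of `c` of norm `1` and a coefficient of `x` of maximal norm, some product is
the only one in its degree, and so dominates a coefficient of `c * x`. -/
theorem mem_gaussSubring_of_mul_mem [UniqueSums G] {ν : Valuation K Γ}
    {c x : AddMonoidAlgebra K G} (hc : c ∈ gaussSubring G ν) {g₀ : G} (hg₀ : ν (c.coeff g₀) = 1)
    (h : c * x ∈ gaussSubring G ν) : x ∈ gaussSubring G ν := by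
  classical
  by_contra hx
  rw [mem_gaussSubring] at hx
  push Not at hx
  obtain ⟨g₁, hg₁⟩ := hx
  have hsupp : ∀ {y : AddMonoidAlgebra K G} {g : G}, ν (y.coeff g) ≠ 0 → g ∈ y.coeff.support :=
    fun hy => Finsupp.mem_support_iff.2 fun h0 => hy (by rw [h0, map_zero])
  obtain ⟨m, hm, hmax⟩ := Finset.exists_max_image x.coeff.support (fun g => ν (x.coeff g))
    ⟨g₁, hsupp (zero_lt_one.trans hg₁).ne'⟩
  have hM : 1 < ν (x.coeff m) := hg₁.trans_le (hmax g₁ (hsupp (zero_lt_one.trans hg₁).ne'))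
  set M := ν (x.coeff m) with hM'
  have hM0 : M ≠ 0 := (zero_lt_one.trans hM).ne'
  obtain ⟨i, hi, j, hj, hu⟩ := UniqueSums.uniqueAdd_of_nonempty
    (A := c.coeff.support.filter fun g => ν (c.coeff g) = 1)
    (B := x.coeff.support.filter fun g => ν (x.coeff g) = M)
    ⟨g₀, Finset.mem_filter.2 ⟨hsupp (by rw [hg₀]; exact one_ne_zero), hg₀⟩⟩
    ⟨m, Finset.mem_filter.2 ⟨hm, rfl⟩⟩
  rw [Finset.mem_filter] at hi hj
  have hij : (i, j) ∈ c.coeff.support ×ˢ x.coeff.support := Finset.mk_mem_product hi.1 hj.1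
  have hcoeff := h (i + j)
  rw [coeff_mul, Finsupp.sum] at hcoeff
  simp only [Finsupp.sum] at hcoeff
  rw [← Finset.sum_product', ← Finset.add_sum_erase _ _ hij, if_pos rfl] at hcoeff
  have hlead : ν (c.coeff i * x.coeff j) = M := by rw [map_mul, hi.2, hj.2, one_mul]
  rw [ν.map_add_eq_of_lt_left, hlead] at hcoeff
  · exact hM.not_ge hcoeff
  · rw [hlead]
    refine ν.map_sum_lt hM0 fun ab hab => ?_
    obtain ⟨hne, hab⟩ := Finset.mem_erase.1 hab
    obtain ⟨ha, hb⟩ := Finset.mem_product.1 hab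
    split_ifs with hs
    · rw [map_mul]
      rcases (hc ab.1).lt_or_eq with hlt | heq
      · exact (mul_le_mul_right (hmax _ hb) _).trans_lt
          (mul_lt_of_lt_one_left (zero_lt_iff.2 hM0) hlt)
      · rcases (hmax _ hb).lt_or_eq with hlt' | heq'
        · rwa [heq, one_mul]
        · have := hu (Finset.mem_filter.2 ⟨ha, heq⟩) (Finset.mem_filter.2 ⟨hb, heq'⟩) hs
          exact (hne (Prod.ext this.1 this.2)).elim
    · rw [map_zero]
      exact zero_lt_iff.2 hM0

end AddMonoidAlgebra

/-! ### Expansion of formal series by a grading -/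

theorem AddMonoidAlgebra.coeff_mul_eq_finsum {K G : Type*} [Semiring K] [AddCommGroup G]
    (x y : AddMonoidAlgebra K G) (w : G) :
    (x * y).coeff w = ∑ᶠ u, x.coeff u * y.coeff (w - u) := by
  classical
  rw [AddMonoidAlgebra.coeff_mul, finsum_eq_sum_of_support_subset (s := x.coeff.support)]
  · refine Finset.sum_congr rfl fun u _ => ?_
    dsimp only [Finsupp.sum]
    by_cases h : w - u ∈ y.coeff.support
    · rw [Finset.sum_eq_single_of_mem _ h, if_pos (add_sub_cancel u w)]
      intro b _ hb
      rw [if_neg]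
      rintro rfl
      exact hb (add_sub_cancel_left u b).symm
    · rw [Finsupp.notMem_support_iff.1 h, mul_zero]
      refine Finset.sum_eq_zero fun b hb => if_neg ?_
      rintro rfl
      exact h (by rwa [add_sub_cancel_left])
  · intro u hu
    rw [Finset.mem_coe, Finsupp.mem_support_iff]
    exact left_ne_zero_of_mul hu

namespace AHypergeometric.Series

open PowerSeries (coeff)

variable {N : ℕ}

/-- `F` is the expansion of the formal series `f` by the grading `ω` of the exponents:
the exponents of `f` have degrees in `ℕ`, and the coefficient of `t ^ j` in `F` is the part of
degree `j` of `f`, which therefore has finitely many terms. -/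
structure IsExpansion (ω : (Fin N → ℚ) →+ ℚ) (f : Series N)
    (F : PowerSeries (AddMonoidAlgebra ℚ (Fin N → ℚ))) : Prop where
  exists_nat : ∀ w, f w ≠ 0 → ∃ j : ℕ, ω w = j
  coeff_eq : ∀ (j : ℕ) w, (coeff j F).coeff w = if ω w = j then f w else 0

variable {ω : (Fin N → ℚ) →+ ℚ} {f g : Series N}
  {F G : PowerSeries (AddMonoidAlgebra ℚ (Fin N → ℚ))}

theorem exists_isExpansion (h : ∀ w, f w ≠ 0 → ∃ j : ℕ, ω w = j)
    (hfin : ∀ j : ℕ, {w | f w ≠ 0 ∧ ω w = j}.Finite) : ∃ F, IsExpansion ω f F := by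
  have hsupp : ∀ j : ℕ, (Function.support fun w => if ω w = j then f w else 0).Finite :=
    fun j => (hfin j).subset fun w hw => by
      simpa [and_comm] using hw
  exact ⟨PowerSeries.mk fun j => .ofCoeff (Finsupp.ofSupportFinite _ (hsupp j)), h, fun j w => by
    rw [PowerSeries.coeff_mk, AddMonoidAlgebra.coeff_ofCoeff, Finsupp.ofSupportFinite_coe]⟩

namespace IsExpansion

theorem coeff_ne_zero (hf : IsExpansion ω f F) {j : ℕ} {w : Fin N → ℚ}
    (h : (coeff j F).coeff w ≠ 0) : ω w = j := by
  rw [hf.coeff_eq] at h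
  exact (ite_ne_right_iff.1 h).1

theorem zero : IsExpansion ω (0 : Series N) 0 :=
  ⟨fun _ h => (h rfl).elim, fun j w => by simp⟩

theorem one : IsExpansion ω (Series.one N) 1 := by
  classical
  refine ⟨fun w hw => ⟨0, ?_⟩, fun j w => ?_⟩
  · by_cases h : w = 0
    · simp [h]
    · exact (hw (Pi.single_eq_of_ne h _)).elim
  · rw [PowerSeries.coeff_one]
    by_cases h : w = 0
    · subst h
      rcases eq_or_ne j 0 with rfl | hj
      · simp [Series.one, AddMonoidAlgebra.one_def]
      · have hj' : (0 : ℚ) ≠ j := by exact_mod_cast hj.symm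
        simp [hj, hj']
    · split_ifs <;> simp [Series.one, AddMonoidAlgebra.one_def, h]

theorem eq (hf : IsExpansion ω f F) (hf' : IsExpansion ω f G) : F = G := by
  ext j w
  rw [hf.coeff_eq, hf'.coeff_eq]

theorem mul (hf : IsExpansion ω f F) (hg : IsExpansion ω g G) :
    IsExpansion ω (Series.mul f g) (F * G) := by
  refine ⟨fun w hw => ?_, fun n w => ?_⟩
  · obtain ⟨u, hu⟩ : ∃ u, f u * g (w - u) ≠ 0 := by
      by_contra! h
      exact hw (finsum_eq_zero_of_forall_eq_zero h)
    obtain ⟨i, hi⟩ := hf.exists_nat u (left_ne_zero_of_mul hu)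
    obtain ⟨j, hj⟩ := hg.exists_nat (w - u) (right_ne_zero_of_mul hu)
    refine ⟨i + j, ?_⟩
    rw [← add_sub_cancel u w, map_add, hi, hj, Nat.cast_add]
  · have hsum : ∀ {p : ℕ × ℕ} {u : Fin N → ℚ}, p ∈ Finset.HasAntidiagonal.antidiagonal n →
        (coeff p.1 F).coeff u * (coeff p.2 G).coeff (w - u) ≠ 0 → ω w = n := fun hp hu => by
      rw [← add_sub_cancel _ w, map_add, hf.coeff_ne_zero (left_ne_zero_of_mul hu),
        hg.coeff_ne_zero (right_ne_zero_of_mul hu), ← Nat.cast_add,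
        Finset.HasAntidiagonal.mem_antidiagonal.1 hp]
    rw [PowerSeries.coeff_mul, AddMonoidAlgebra.coeff_sum, Finsupp.finsetSum_apply]
    simp only [AddMonoidAlgebra.coeff_mul_eq_finsum]
    split_ifs with hw
    · rw [← finsum_sum_comm, Series.mul]
      · refine finsum_congr fun u => ?_
        by_cases hu : f u * g (w - u) = 0
        · rw [hu]
          refine Finset.sum_eq_zero fun p _ => ?_
          rw [hf.coeff_eq, hg.coeff_eq]
          split_ifs <;> simp [hu]
        · obtain ⟨i, hi⟩ := hf.exists_nat u (left_ne_zero_of_mul hu)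
          obtain ⟨j, hj⟩ := hg.exists_nat (w - u) (right_ne_zero_of_mul hu)
          rw [Finset.sum_eq_single (i, j), hf.coeff_eq, hg.coeff_eq, if_pos hi, if_pos hj]
          · intro p _ hp
            by_contra h
            have h1 := hf.coeff_ne_zero (left_ne_zero_of_mul h)
            have h2 := hg.coeff_ne_zero (right_ne_zero_of_mul h)
            rw [hi, Nat.cast_inj] at h1
            rw [hj, Nat.cast_inj] at h2
            exact hp (Prod.ext h1.symm h2.symm)
          · intro hij
            refine (hij ?_).elim
            rw [← add_sub_cancel u w, map_add, hi, hj, ← Nat.cast_add, Nat.cast_inj] at hw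
            exact Finset.HasAntidiagonal.mem_antidiagonal.2 hw
      · intro p _
        refine (coeff p.1 F).coeff.support.finite_toSet.subset fun u hu => ?_
        rw [Finset.mem_coe, Finsupp.mem_support_iff]
        exact left_ne_zero_of_mul hu
    · refine Finset.sum_eq_zero fun p hp => finsum_eq_zero_of_forall_eq_zero fun u => ?_
      by_contra hu
      exact hw (hsum hp hu)

theorem pow (hf : IsExpansion ω f F) (k : ℕ) : IsExpansion ω (Series.pow f k) (F ^ k) := by
  induction k with
  | zero => rw [pow_zero]; exact one
  | succ k ih => rw [pow_succ]; exact ih.mul hf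

theorem sum {ι : Type*} {s : Finset ι} {f : ι → Series N}
    {F : ι → PowerSeries (AddMonoidAlgebra ℚ (Fin N → ℚ))}
    (h : ∀ i ∈ s, IsExpansion ω (f i) (F i)) :
    IsExpansion ω (∑ i ∈ s, f i) (∑ i ∈ s, F i) := by
  refine ⟨fun w hw => ?_, fun j w => ?_⟩
  · rw [Finset.sum_apply] at hw
    obtain ⟨i, hi, hne⟩ := Finset.exists_ne_zero_of_sum_ne_zero hw
    exact (h i hi).exists_nat w hne
  · rw [map_sum, AddMonoidAlgebra.coeff_sum, Finsupp.finsetSum_apply, Finset.sum_apply,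
      Finset.sum_congr rfl fun i hi => (h i hi).coeff_eq j w]
    split_ifs <;> simp

end IsExpansion

/-- Multiplication of a formal series by the monomial `λ ^ e`. -/
def translate (e : Fin N → ℚ) (f : Series N) : Series N := fun w => f (w - e)

theorem translate_mul (e : Fin N → ℚ) (f g : Series N) :
    mul (translate e f) g = translate e (mul f g) := by
  funext w
  simp only [mul, translate]
  rw [← finsum_comp_equiv (Equiv.addRight e)]
  refine finsum_congr fun u => ?_
  simp only [Equiv.coe_addRight, add_sub_cancel_right]
  rw [sub_sub, add_comm u e]

theorem ofPolynomial_coe (q : MvPolynomial (Fin N) ℚ) (d : Fin N →₀ ℕ) :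
    ofPolynomial q (fun i => (d i : ℚ)) = q.coeff d := by
  refine Function.Injective.extend_apply (fun d d' h => ?_) _ _ _
  ext i
  exact_mod_cast congr_fun h i

theorem exists_of_ofPolynomial_ne_zero {q : MvPolynomial (Fin N) ℚ} {w : Fin N → ℚ}
    (h : ofPolynomial q w ≠ 0) : ∃ d ∈ q.support, w = fun i => (d i : ℚ) := by
  by_cases hw : ∃ d : Fin N →₀ ℕ, (fun i => (d i : ℚ)) = w
  · obtain ⟨d, rfl⟩ := hw
    rw [ofPolynomial_coe] at h
    exact ⟨d, MvPolynomial.mem_support_iff.2 h, rfl⟩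
  · exact (h (Function.extend_apply' _ _ _ hw)).elim

end AHypergeometric.Series

/-! ### Eisenstein's theorem for formal series -/

namespace AHypergeometric.Series

open Filter
open PowerSeries (coeff)
open AddMonoidAlgebra (gaussSubring mem_gaussSubring_of_mul_mem)

variable {N : ℕ} {ω : (Fin N → ℚ) →+ ℚ}

/-- Finitely many integral exponents can be moved to degrees in `ℕ` by one translation. -/
theorem exists_translate_degree_nat (hω : ∀ d : Fin N →₀ ℕ, ∃ z : ℤ, ω (fun i => (d i : ℚ)) = z)
    (D : Finset (Fin N →₀ ℕ)) :
    ∃ e, ∀ d ∈ D, ∃ j : ℕ, ω ((fun i => (d i : ℚ)) + e) = j := by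
  by_cases h0 : ω = 0
  · exact ⟨0, fun d _ => ⟨0, by simp [h0]⟩⟩
  obtain ⟨x, hx⟩ : ∃ x, ω x ≠ 0 := by
    by_contra! h
    exact h0 (AddMonoidHom.ext h)
  choose z hz using hω
  refine ⟨((∑ d ∈ D, (z d).natAbs : ℕ) / ω x : ℚ) • x, fun d hd =>
    ⟨(z d + (∑ d ∈ D, (z d).natAbs : ℕ)).toNat, ?_⟩⟩
  have h1 : (z d).natAbs ≤ ∑ d ∈ D, (z d).natAbs :=
    Finset.single_le_sum (f := fun d => (z d).natAbs) (fun _ _ => Nat.zero_le _) hd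
  have h2 : 0 ≤ z d + (∑ d ∈ D, (z d).natAbs : ℕ) := by omega
  rw [map_add, hz, map_rat_smul, smul_eq_mul, div_mul_cancel₀ _ hx, ← Int.cast_natCast (R := ℚ)
    (Int.toNat _), Int.toNat_of_nonneg h2, Int.cast_add, Int.cast_natCast]

theorem exists_isExpansion_translate_ofPolynomial {e : Fin N → ℚ} {q : MvPolynomial (Fin N) ℚ}
    (h : ∀ d ∈ q.support, ∃ j : ℕ, ω ((fun i => (d i : ℚ)) + e) = j) :
    ∃ F, IsExpansion ω (translate e (ofPolynomial q)) F := by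
  have hw : ∀ w, translate e (ofPolynomial q) w ≠ 0 →
      ∃ d ∈ q.support, (fun i => (d i : ℚ)) + e = w := fun w hw => by
    obtain ⟨d, hd, h⟩ := exists_of_ofPolynomial_ne_zero hw
    exact ⟨d, hd, by rw [← h, sub_add_cancel]⟩
  refine exists_isExpansion (fun w hne => ?_) fun j => ?_
  · obtain ⟨d, hd, rfl⟩ := hw w hne
    exact h d hd
  · refine (q.support.finite_toSet.image fun d => (fun i => (d i : ℚ)) + e).subset fun w hne => ?_
    exact hw w hne.1

theorem eventually_not_dvd_of_ne_zero {n : ℕ} (h : n ≠ 0) : ∀ᶠ q in atTop, ¬ q ∣ n :=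
  (eventually_gt_atTop n).mono fun _ hq hd => hq.not_ge (Nat.le_of_dvd (Nat.pos_of_ne_zero h) hd)

theorem eventually_not_dvd_den {G : Type*} (x : AddMonoidAlgebra ℚ G) :
    ∀ᶠ q in atTop, ∀ g, ¬ q ∣ (x.coeff g).den := by
  have h : ∀ᶠ q in atTop, q ≠ 1 ∧ ∀ g ∈ x.coeff.support, ¬ q ∣ (x.coeff g).den :=
    (eventually_ne_atTop 1).and ((eventually_all_finset _).2 fun g _ =>
      eventually_not_dvd_of_ne_zero (x.coeff g).den_ne_zero)
  filter_upwards [h] with q hq g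
  by_cases hg : g ∈ x.coeff.support
  · exact hq.2 g hg
  · simpa [Finsupp.notMem_support_iff.1 hg] using hq.1

/-- Eisenstein's theorem for formal series: an algebraic series that has an expansion by some
grading has `q`-integral coefficients for all but finitely many primes `q`. -/
theorem IsExpansion.eventually_hasPIntegralCoeffs {f : Series N}
    {F : PowerSeries (AddMonoidAlgebra ℚ (Fin N → ℚ))} (hF : IsExpansion ω f F)
    (hω : ∀ d : Fin N →₀ ℕ, ∃ z : ℤ, ω (fun i => (d i : ℚ)) = z)
    (hf : f.IsAlgebraicOverRatFunc) :
    ∀ᶠ q : ℕ in atTop, q.Prime → f.HasPIntegralCoeffs q := by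
  obtain ⟨P, hP, hPf⟩ := hf
  obtain ⟨e, he⟩ := exists_translate_degree_nat hω
    (P.support.biUnion fun k => (P.coeff k).support)
  have hQ : ∀ k, ∃ Q, IsExpansion ω (translate e (ofPolynomial (P.coeff k))) Q := fun k => by
    refine exists_isExpansion_translate_ofPolynomial fun d hd => ?_
    refine he d (Finset.mem_biUnion.2 ⟨k, Polynomial.mem_support_iff.2 fun h0 => ?_, hd⟩)
    simp [h0] at hd
  choose Q hQ using hQ
  have hQcoeff : ∀ k j w, (coeff j (Q k)).coeff w ≠ 0 →
      ∃ d ∈ (P.coeff k).support, (coeff j (Q k)).coeff w = (P.coeff k).coeff d := by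
    intro k j w hne
    rw [(hQ k).coeff_eq] at hne ⊢
    obtain ⟨hj, hne⟩ := ite_ne_right_iff.1 hne
    obtain ⟨d, hd, hw⟩ := exists_of_ofPolynomial_ne_zero hne
    refine ⟨d, hd, ?_⟩
    rw [if_pos hj, translate, hw, ofPolynomial_coe]
  set P' : Polynomial (PowerSeries (AddMonoidAlgebra ℚ (Fin N → ℚ))) :=
    ∑ k ∈ P.support, Polynomial.monomial k (Q k) with hP'
  have hcoeff : ∀ k, P'.coeff k = if k ∈ P.support then Q k else 0 := fun k => by
    simp [hP', Polynomial.coeff_monomial]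
  have hP'0 : P' ≠ 0 := fun h0 => by
    obtain ⟨k, hk⟩ := Polynomial.support_nonempty.2 hP
    obtain ⟨d, hd⟩ := MvPolynomial.support_nonempty.2 (Polynomial.mem_support_iff.1 hk)
    have hQ0 : Q k = 0 := by rw [← if_pos (c := k ∈ P.support) hk (t := Q k) (e := 0), ← hcoeff,
      h0, Polynomial.coeff_zero]
    obtain ⟨j, hj⟩ := he d (Finset.mem_biUnion.2 ⟨k, hk, hd⟩)
    have := (hQ k).coeff_eq j ((fun i => (d i : ℚ)) + e)
    rw [if_pos hj, hQ0, translate, add_sub_cancel_right, ofPolynomial_coe] at this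
    exact MvPolynomial.mem_support_iff.1 hd (by simpa using this.symm)
  have heval : P'.eval F = 0 := by
    have h1 := IsExpansion.sum (s := P.support) fun k _ => (hQ k).mul (hF.pow k)
    have h2 : ∑ k ∈ P.support,
        Series.mul (translate e (ofPolynomial (P.coeff k))) (Series.pow f k) = 0 := by
      funext w
      have := congr_fun hPf (w - e)
      rw [Finset.sum_apply] at this ⊢
      simp only [translate_mul, translate]
      exact this
    rw [h2] at h1
    rw [hP', Polynomial.eval_finsetSum, ← h1.eq IsExpansion.zero]
    simp only [Polynomial.eval_monomial]
  have : CharZero (AddMonoidAlgebra ℚ (Fin N → ℚ)) := algebraRat.charZero _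
  obtain ⟨T, c, hc0, h⟩ := PowerSeries.exists_finset_mem_of_eval_eq_zero hP'0 heval
  obtain ⟨g₀, hg₀⟩ : ∃ g, c.coeff g ≠ 0 := by
    by_contra! h
    exact hc0 (AddMonoidAlgebra.coeff_injective (Finsupp.ext h))
  have hnum := eventually_not_dvd_of_ne_zero (Int.natAbs_ne_zero.2 (Rat.num_ne_zero.2 hg₀))
  have hT : ∀ᶠ q in atTop, ∀ x ∈ T, ∀ g, ¬ q ∣ (x.coeff g).den :=
    (eventually_all_finset _).2 fun x _ => eventually_not_dvd_den x
  have hPint : ∀ᶠ q in atTop, ∀ k ∈ P.support, ∀ d ∈ (P.coeff k).support,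
      ¬ q ∣ ((P.coeff k).coeff d).den :=
    (eventually_all_finset _).2 fun k _ => (eventually_all_finset _).2 fun d _ =>
      eventually_not_dvd_of_ne_zero (Rat.den_ne_zero _)
  filter_upwards [hnum, hT, hPint, eventually_not_dvd_den c] with q hqnum hqT hqP hqc hq
  have : Fact q.Prime := ⟨hq⟩
  have hmem : ∀ {x : AddMonoidAlgebra ℚ (Fin N → ℚ)}, (∀ g, ¬ q ∣ (x.coeff g).den) →
      x ∈ gaussSubring _ (Rat.padicValuation q) := fun hx g =>
    Rat.padicValuation_le_one_iff.2 (hx g)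
  have hg₀1 : Rat.padicValuation q (c.coeff g₀) = 1 := by
    refine le_antisymm (Rat.padicValuation_le_one_iff.2 (hqc g₀)) ?_
    have hinv : Rat.padicValuation q (c.coeff g₀)⁻¹ ≤ 1 := by
      rw [Rat.padicValuation_le_one_iff, Rat.den_inv_of_ne_zero hg₀]
      exact hqnum
    rw [map_inv₀] at hinv
    exact (inv_le_one₀ (zero_lt_iff.2 ((Valuation.ne_zero_iff _).2 hg₀))).1 hinv
  have hFS := h (gaussSubring _ (Rat.padicValuation q)) (fun k n => ?_) (fun x hx => hmem (hqT x hx))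
    fun x hx => mem_gaussSubring_of_mul_mem (hmem hqc) hg₀1 hx
  · intro w
    by_cases hw : f w = 0
    · simpa [IsPIntegral, hw] using hq.ne_one
    · obtain ⟨j, hj⟩ := hF.exists_nat w hw
      have := hFS j w
      rwa [hF.coeff_eq, if_pos hj, Rat.padicValuation_le_one_iff] at this
  · rw [hcoeff]
    split_ifs with hk
    · refine hmem fun g => ?_
      by_cases hg : (coeff n (Q k)).coeff g = 0
      · simpa [hg] using hq.ne_one
      · obtain ⟨d, hd, hdeq⟩ := hQcoeff k n g hg
        rw [hdeq]
        exact hqP k hk d hd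
    · rw [map_zero]
      exact Subring.zero_mem _

end AHypergeometric.Series

/-! ### The exponents of the hypergeometric series -/

namespace AHypergeometric

open Filter

variable {n N : ℕ} {a : Fin N → Fin n → ℤ} {v : Fin N → ℚ}

/-- For `-1 ≤ vᵢ ≤ 0`, the set `L_v` is cut out of the lattice `L` by sign conditions. -/
theorem mem_Lv_iff (hv : ∀ i, -1 ≤ v i ∧ v i ≤ 0) {l : Fin N → ℤ} :
    l ∈ Lv a v ↔ l ∈ relationLattice a ∧
      ∀ i, (v i = 0 → 0 ≤ l i) ∧ (v i = -1 → l i ≤ 0) := by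
  refine and_congr_right fun _ => ⟨fun h i => ?_, fun h => Set.ext fun i => ?_⟩
  · have hi : (∃ m : ℤ, m < 0 ∧ v i + l i = m) ↔ ∃ m : ℤ, m < 0 ∧ v i = m :=
      Set.ext_iff.1 h i
    refine ⟨fun h0 => ?_, fun h1 => ?_⟩
    · by_contra! hl
      obtain ⟨m, hm, hvm⟩ := hi.1 ⟨l i, hl, by rw [h0, zero_add]⟩
      rw [h0] at hvm
      exact hm.ne (by exact_mod_cast hvm.symm)
    · obtain ⟨m, hm, hvm⟩ := hi.2 ⟨-1, by norm_num, by rw [h1]; norm_num⟩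
      rw [h1] at hvm
      have : -1 + l i = m := by exact_mod_cast hvm
      omega
  · obtain ⟨h0, h1⟩ := h i
    obtain ⟨hv1, hv0⟩ := hv i
    constructor
    · rintro ⟨m, hm, hvm⟩
      have hvm' : v i = ((m - l i : ℤ) : ℚ) := by
        push_cast
        exact eq_sub_of_add_eq hvm
      rw [hvm'] at hv0 hv1
      have h2 : -1 ≤ m - l i := by exact_mod_cast hv1
      have h3 : m - l i ≤ 0 := by exact_mod_cast hv0
      rcases h3.lt_or_eq with h4 | h4
      · exact ⟨m - l i, h4, hvm'⟩
      · have := h0 (by rw [hvm', h4, Int.cast_zero])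
        omega
    · rintro ⟨m, hm, hvm⟩
      have h2 : -1 ≤ m := by
        rw [hvm] at hv1
        exact_mod_cast hv1
      have hm1 : m = -1 := by omega
      subst hm1
      have := h1 (by rw [hvm]; norm_num)
      exact ⟨-1 + l i, by omega, by rw [shift, hvm]; push_cast; rfl⟩

theorem nsmul_mem_Lv (hv : ∀ i, -1 ≤ v i ∧ v i ≤ 0) {l : Fin N → ℤ} (hl : l ∈ Lv a v) (k : ℕ) :
    (fun i => k * l i) ∈ Lv a v := by
  rw [mem_Lv_iff hv] at hl ⊢
  refine ⟨?_, fun i => ⟨fun h => mul_nonneg (Int.natCast_nonneg k) ((hl.2 i).1 h),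
    fun h => mul_nonpos_of_nonneg_of_nonpos (Int.natCast_nonneg k) ((hl.2 i).2 h)⟩⟩
  have := hl.1
  simp only [relationLattice, Set.mem_ofPred_eq] at this ⊢
  simp only [mul_smul, ← Finset.smul_sum, this, smul_zero]

/-- If `L_v` lies in a pointed cone, a relation is determined by its coordinates at
the indices with `vᵢ = 0` or `vᵢ = -1`: otherwise the cone would contain a line. -/
theorem eq_of_eq_of_integer (hv : ∀ i, -1 ≤ v i ∧ v i ≤ 0) (hcone : LiesInPointedCone (Lv a v))
    {l l' : Fin N → ℤ} (hl : l ∈ relationLattice a) (hl' : l' ∈ relationLattice a)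
    (h : ∀ i, v i = 0 ∨ v i = -1 → l i = l' i) : l = l' := by
  obtain ⟨C, -, hC, hsub⟩ := hcone
  have hd : ∀ {l l' : Fin N → ℤ}, l ∈ relationLattice a → l' ∈ relationLattice a →
      (∀ i, v i = 0 ∨ v i = -1 → l i = l' i) → l - l' ∈ Lv a v := fun {l l'} hl hl' h => by
    rw [mem_Lv_iff hv]
    refine ⟨?_, fun i => ⟨fun h0 => ?_, fun h1 => ?_⟩⟩
    · simp only [relationLattice, Set.mem_ofPred_eq] at hl hl' ⊢
      simp only [Pi.sub_apply, sub_smul, Finset.sum_sub_distrib, hl, hl', sub_zero]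
    · rw [Pi.sub_apply, h i (Or.inl h0), sub_self]
    · rw [Pi.sub_apply, h i (Or.inr h1), sub_self]
  by_contra hne
  refine hC _ (hsub _ (hd hl hl' h)) (fun h0 => hne ?_) ?_
  · funext i
    have : ((l i - l' i : ℤ) : ℝ) = 0 := congr_fun h0 i
    exact sub_eq_zero.1 (by exact_mod_cast this)
  · convert hsub _ (hd hl' hl fun i hi => (h i hi).symm) using 1
    funext i
    simp

theorem shift_injective (v : Fin N → ℚ) : Function.Injective (shift v) := fun l l' h => by
  funext i
  have := congr_fun h i
  simpa [shift] using this

theorem Phi_shift {l : Fin N → ℤ} (hl : l ∈ Lv a v) : Phi a v (shift v l) = vbracket v l :=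
  Function.Injective.extend_apply (f := fun l : Lv a v => shift v l.1)
    (fun _ _ h => Subtype.ext (shift_injective v h)) _ _ ⟨l, hl⟩

theorem exists_of_Phi_ne_zero {w : Fin N → ℚ} (h : Phi a v w ≠ 0) :
    ∃ l ∈ Lv a v, shift v l = w := by
  by_contra! hw
  exact h (Function.extend_apply' _ _ _ fun ⟨l, hl⟩ => hw l.1 l.2 hl)

/-- The sign by which the `i`-th coordinate of an exponent enters the degree, for `r = vᵢ`: it makes
the contributions of all exponents of `Φ_v` nonnegative, and it is zero where `vᵢ` is not an
integer. -/
def degreeSign (r : ℚ) : ℤ := if r = 0 then 1 else if r = -1 then -1 else 0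

/-- The grading of the exponents for which `Φ_v` has finitely many terms in each degree. -/
noncomputable def degree (v : Fin N → ℚ) : (Fin N → ℚ) →+ ℚ :=
  ∑ i, (AddMonoidHom.mulLeft (degreeSign (v i) : ℚ)).comp (Pi.evalAddMonoidHom (fun _ => ℚ) i)

theorem degree_apply (v w : Fin N → ℚ) : degree v w = ∑ i, (degreeSign (v i) : ℚ) * w i := by
  simp [degree]

theorem exists_isExpansion_Phi (hv : ∀ i, -1 ≤ v i ∧ v i ≤ 0)
    (hcone : LiesInPointedCone (Lv a v)) : ∃ F, Series.IsExpansion (degree v) (Phi a v) F := by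
  have hterm : ∀ l ∈ Lv a v, ∀ i, ∃ m : ℕ, (degreeSign (v i) : ℚ) * shift v l i = m := by
    intro l hl i
    obtain ⟨h0, h1⟩ := ((mem_Lv_iff hv).1 hl).2 i
    rw [degreeSign, shift]
    split_ifs with hi hi'
    · exact ⟨(l i).toNat, by
        rw [hi, zero_add, Int.cast_one, one_mul, ← Int.cast_natCast, Int.toNat_of_nonneg (h0 hi)]⟩
    · have : 0 ≤ 1 - l i := by linarith [h1 hi']
      exact ⟨(1 - l i).toNat, by
        rw [hi', ← Int.cast_natCast, Int.toNat_of_nonneg this]; push_cast; ring⟩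
    · exact ⟨0, by simp⟩
  refine Series.exists_isExpansion (fun w hw => ?_) fun j => ?_
  · obtain ⟨l, hl, rfl⟩ := exists_of_Phi_ne_zero hw
    choose m hm using hterm l hl
    exact ⟨∑ i, m i, by rw [degree_apply, Finset.sum_congr rfl fun i _ => hm i, Nat.cast_sum]⟩
  · -- the terms of the degree are natural numbers bounded by `j`, and they determine `l`
    refine Set.Finite.of_finite_image (f := fun w i => (degreeSign (v i) : ℚ) * w i)
      ((Set.Finite.pi' fun _ : Fin N => (Set.finite_Iic j).image ((↑) : ℕ → ℚ)).subset ?_) ?_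
    · rintro _ ⟨w, ⟨hw, hj⟩, rfl⟩ i
      obtain ⟨l, hl, rfl⟩ := exists_of_Phi_ne_zero hw
      choose m hm using hterm l hl
      rw [degree_apply, Finset.sum_congr rfl fun i _ => hm i, ← Nat.cast_sum, Nat.cast_inj] at hj
      exact ⟨m i, hj ▸ Finset.single_le_sum (f := m) (fun _ _ => Nat.zero_le _)
        (Finset.mem_univ i), (hm i).symm⟩
    · rintro w ⟨hw, -⟩ w' ⟨hw', -⟩ heq
      obtain ⟨l, hl, rfl⟩ := exists_of_Phi_ne_zero hw
      obtain ⟨l', hl', rfl⟩ := exists_of_Phi_ne_zero hw'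
      congr 1
      refine eq_of_eq_of_integer hv hcone hl.1 hl'.1 fun i hi => ?_
      have hne : (degreeSign (v i) : ℚ) ≠ 0 := by
        rcases hi with hi | hi <;> simp [degreeSign, hi]
      have := mul_left_cancel₀ hne (congr_fun heq i)
      simpa [shift] using this

/-- If `Φ_v` is algebraic, its coefficients are `q`-integral for almost all primes `q`. -/
theorem eventually_Phi_hasPIntegralCoeffs (hv : ∀ i, -1 ≤ v i ∧ v i ≤ 0)
    (hcone : LiesInPointedCone (Lv a v)) (halg : (Phi a v).IsAlgebraicOverRatFunc) :
    ∀ᶠ q : ℕ in atTop, q.Prime → (Phi a v).HasPIntegralCoeffs q := by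
  obtain ⟨F, hF⟩ := exists_isExpansion_Phi hv hcone
  refine hF.eventually_hasPIntegralCoeffs (fun d => ⟨∑ i, degreeSign (v i) * d i, ?_⟩) halg
  rw [degree_apply]
  push_cast
  rfl

end AHypergeometric

/-! ### Valuations of the coefficients -/

namespace AHypergeometric

open Finset

/-- The floor function jumps exactly at the multiples of `P`. -/
theorem add_one_ediv {P : ℤ} (hP : 0 < P) (k : ℤ) :
    (k + 1) / P = k / P + if P ∣ k + 1 then 1 else 0 := by
  have h1 := Int.emod_add_mul_ediv k P
  have h2 := Int.emod_nonneg k hP.ne'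
  have h3 := Int.emod_lt_of_pos k hP
  split_ifs with h
  · obtain ⟨t, ht⟩ := h
    have h4 : k / P = t - 1 := by
      rw [Int.ediv_eq_iff_of_pos hP]
      constructor <;> linarith
    rw [ht, Int.mul_ediv_cancel_left _ hP.ne', h4, sub_add_cancel]
  · rw [add_zero, Int.ediv_eq_iff_of_pos hP]
    have h4 : k % P + 1 ≠ P := fun h4 => h ⟨k / P + 1, by linarith⟩
    have h5 : k % P + 1 < P := by omega
    constructor <;> linarith

theorem padicValInt_eq_sum {p b : ℕ} [Fact p.Prime] {z : ℤ} (hz : z ≠ 0) (hb : |z| < p ^ b) :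
    (padicValInt p z : ℤ) = ∑ s ∈ Ico 1 b, if (p : ℤ) ^ s ∣ z then 1 else 0 := by
  have hp := Fact.out (p := p.Prime)
  have hz' : z.natAbs ≠ 0 := Int.natAbs_ne_zero.2 hz
  have hlog : Nat.log p z.natAbs < b := by
    refine Nat.log_lt_of_lt_pow hz' ?_
    zify
    exact hb
  have h := (padicValNat_eq_emultiplicity (p := p) hz').trans
    (Nat.emultiplicity_eq_card_pow_dvd hp.ne_one (Nat.pos_of_ne_zero hz') hlog)
  rw [padicValInt, ENat.natCast_inj.1 h, card_filter, Nat.cast_sum]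
  refine sum_congr rfl fun s _ => ?_
  have : (p : ℤ) ^ s ∣ z ↔ p ^ s ∣ z.natAbs := by
    rw [← Int.natCast_dvd, Nat.cast_pow]
  simp only [this, Nat.cast_ite, Nat.cast_one, Nat.cast_zero]

section Bracket

variable {p b D : ℕ} {m : ℤ} {r : ℚ} {ρ : ℕ → ℤ}

/-- The valuation of the factors of `[r]_k` for `r = -m / D`, where `ρ s ≡ r` modulo `p ^ s`. -/
theorem padicValRat_add_eq_sum [Fact p.Prime] (hD : ¬ p ∣ D) (hr : r = -m / D)
    (hρ : ∀ s ∈ Ico 1 b, (p : ℤ) ^ s ∣ D * ρ s + m) {j : ℤ} (hj : r + j ≠ 0)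
    (hb : |D * j - m| < p ^ b) :
    padicValRat p (r + j) = ∑ s ∈ Ico 1 b, if (p : ℤ) ^ s ∣ j + ρ s then 1 else 0 := by
  have hD0 : (D : ℚ) ≠ 0 := by
    rintro h
    exact hD (by rw [Nat.cast_eq_zero.1 h]; exact dvd_zero p)
  have hrj : r + j = ((D * j - m : ℤ) : ℚ) / D := by
    rw [hr, eq_div_iff hD0]
    push_cast
    field_simp
    ring
  have hz : D * j - m ≠ 0 := fun h => hj (by rw [hrj, h, Int.cast_zero, zero_div])
  rw [hrj, padicValRat.div (by exact_mod_cast hz) hD0, padicValRat.of_int, padicValRat.of_nat,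
    padicValNat.eq_zero_of_not_dvd hD, Nat.cast_zero, sub_zero, padicValInt_eq_sum hz hb]
  refine sum_congr rfl fun s hs => ?_
  have hcop : IsCoprime ((p : ℤ) ^ s) D :=
    (Nat.isCoprime_iff_coprime.2 ((Nat.Prime.coprime_iff_not_dvd Fact.out).2 hD)).pow_left
  have : (p : ℤ) ^ s ∣ D * j - m ↔ (p : ℤ) ^ s ∣ j + ρ s := by
    rw [← dvd_add_left (hρ s hs), sub_add_add_cancel, ← mul_add]
    exact ⟨hcop.dvd_of_dvd_mul_left, fun h => h.mul_left _⟩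
  simp only [this]

theorem bracket_natCast_succ (r : ℚ) (k : ℕ) :
    bracket r ((k + 1 : ℕ) : ℤ) = bracket r (k : ℤ) / (r + ((k : ℤ) + 1 : ℤ)) := by
  change 1 / ∏ j ∈ range (k + 1), (r + ((j : ℚ) + 1)) = 1 / (∏ j ∈ range k, (r + ((j : ℚ) + 1))) / _
  rw [prod_range_succ, div_div]
  push_cast
  rfl

theorem bracket_neg_natCast (r : ℚ) (k : ℕ) :
    bracket r (-(k : ℤ)) = ∏ j ∈ range k, (r - (j : ℚ)) := by
  cases k with
  | zero => simp [bracket]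
  | succ k => rfl

/-- For `-1 ≤ r ≤ 0` the condition on `k` says that `r` and `r + k` are both negative integers or
both not; it excludes vanishing factors in `[r]_k`. -/
theorem padicValRat_bracket [Fact p.Prime] (hD : ¬ p ∣ D) (hr : r = -m / D)
    (hr' : -1 ≤ r ∧ r ≤ 0) (hρ : ∀ s ∈ Ico 1 b, (p : ℤ) ^ s ∣ D * ρ s + m)
    (hρ' : ∀ s ∈ Ico 1 b, 0 ≤ ρ s ∧ ρ s < p ^ s) {k : ℤ}
    (hk : (r = 0 → 0 ≤ k) ∧ (r = -1 → k ≤ 0)) (hm : 0 ≤ m ∧ m ≤ D)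
    (hb : D * (|k| + 1) < (p : ℤ) ^ b) :
    bracket r k ≠ 0 ∧ padicValRat p (bracket r k) = -∑ s ∈ Ico 1 b, (k + ρ s) / p ^ s := by
  have hP : ∀ s, 0 < (p : ℤ) ^ s := fun s =>
    pow_pos (by exact_mod_cast Nat.Prime.pos Fact.out) s
  have hstart : ∑ s ∈ Ico 1 b, (0 + ρ s) / (p : ℤ) ^ s = 0 := sum_eq_zero fun s hs => by
    rw [zero_add]
    exact Int.ediv_eq_zero_of_lt (hρ' s hs).1 (hρ' s hs).2
  have hstep : ∀ j : ℤ, ∑ s ∈ Ico 1 b, (j + 1 + ρ s) / (p : ℤ) ^ s =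
      ∑ s ∈ Ico 1 b, (j + ρ s) / (p : ℤ) ^ s
        + ∑ s ∈ Ico 1 b, if (p : ℤ) ^ s ∣ j + 1 + ρ s then 1 else 0 := fun j => by
    rw [← sum_add_distrib]
    refine sum_congr rfl fun s _ => ?_
    rw [add_right_comm, add_one_ediv (hP s)]
  have hDnn : (0 : ℤ) ≤ D := Int.natCast_nonneg D
  obtain ⟨k, rfl | rfl⟩ := Int.eq_nat_or_neg k
  · induction k with
    | zero => simpa [bracket] using hstart
    | succ k ih =>
      have hr1 : r ≠ -1 := fun h => by
        have := hk.2 h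
        omega
      have hne : r + ((k : ℤ) + 1 : ℤ) ≠ 0 := by
        have := hr'.1.lt_of_ne' hr1
        have h0 : (0 : ℚ) ≤ k := Nat.cast_nonneg k
        push_cast
        intro h
        linarith
      rw [Nat.abs_cast] at hb
      push_cast at hb
      obtain ⟨h0, hval⟩ := ih ⟨fun _ => Int.natCast_nonneg k, fun h => (hr1 h).elim⟩ (by
        rw [Nat.abs_cast]
        nlinarith)
      refine ⟨by rw [bracket_natCast_succ]; exact div_ne_zero h0 hne, ?_⟩
      rw [bracket_natCast_succ, padicValRat.div h0 hne, hval,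
        padicValRat_add_eq_sum hD hr hρ hne, Nat.cast_succ, hstep]
      · ring
      · rw [abs_lt]
        constructor <;> nlinarith
  · induction k with
    | zero => simpa [bracket] using hstart
    | succ k ih =>
      have hr0 : r ≠ 0 := fun h => by
        have := hk.1 h
        push_cast at this
        omega
      have hne : r + ((-k : ℤ) : ℚ) ≠ 0 := by
        have := hr'.2.lt_of_ne hr0
        have h0 : (0 : ℚ) ≤ k := Nat.cast_nonneg k
        push_cast
        intro h
        linarith
      rw [abs_neg, Nat.abs_cast] at hb
      push_cast at hb
      obtain ⟨h0, hval⟩ := ih ⟨fun h => (hr0 h).elim, fun _ => by simp⟩ (by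
        rw [abs_neg, Nat.abs_cast]
        nlinarith)
      have hrec : bracket r (-((k + 1 : ℕ) : ℤ)) = bracket r (-(k : ℤ)) * (r + ((-k : ℤ) : ℚ)) := by
        rw [bracket_neg_natCast, bracket_neg_natCast, prod_range_succ]
        push_cast
        rw [sub_eq_add_neg]
      refine ⟨by rw [hrec]; exact mul_ne_zero h0 hne, ?_⟩
      rw [hrec, padicValRat.mul h0 hne, hval, padicValRat_add_eq_sum hD hr hρ hne]
      · have := hstep (-((k + 1 : ℕ) : ℤ))
        rw [show -((k + 1 : ℕ) : ℤ) + 1 = -(k : ℤ) by push_cast; ring] at this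
        rw [this]
        ring
      · rw [abs_lt]
        constructor <;> nlinarith

end Bracket

theorem padicValRat_prod {ι : Type*} {p : ℕ} [Fact p.Prime] (s : Finset ι) {f : ι → ℚ}
    (h : ∀ i ∈ s, f i ≠ 0) : padicValRat p (∏ i ∈ s, f i) = ∑ i ∈ s, padicValRat p (f i) := by
  classical
  induction s using Finset.induction_on with
  | empty => simp
  | insert i s hi ih =>
    rw [prod_insert hi, sum_insert hi, padicValRat.mul (h i (mem_insert_self i s))
      (prod_ne_zero_iff.2 fun j hj => h j (mem_insert_of_mem hj)),
      ih fun j hj => h j (mem_insert_of_mem hj)]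

/-- The analogue of Legendre's formula: for `v i = -m i / D` and integers `ρ s i ∈ [0, p ^ s)`
congruent to `v i` modulo `p ^ s`, the valuation of `[v]_l` is `-∑ₛ ∑ᵢ ⌊(l i + ρ s i) / p ^ s⌋`. -/
theorem padicValRat_vbracket {N p b D : ℕ} [Fact p.Prime] {v : Fin N → ℚ} {m : Fin N → ℤ}
    {ρ : ℕ → Fin N → ℤ} {l : Fin N → ℤ} (hD : ¬ p ∣ D) (hv : ∀ i, -1 ≤ v i ∧ v i ≤ 0)
    (hvm : ∀ i, v i = -m i / D) (hm : ∀ i, 0 ≤ m i ∧ m i ≤ D)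
    (hρ : ∀ s ∈ Ico 1 b, ∀ i, (p : ℤ) ^ s ∣ D * ρ s i + m i)
    (hρ' : ∀ s ∈ Ico 1 b, ∀ i, 0 ≤ ρ s i ∧ ρ s i < p ^ s)
    (hl : ∀ i, (v i = 0 → 0 ≤ l i) ∧ (v i = -1 → l i ≤ 0))
    (hb : ∀ i, D * (|l i| + 1) < (p : ℤ) ^ b) :
    vbracket v l ≠ 0 ∧
      padicValRat p (vbracket v l) = -∑ s ∈ Ico 1 b, ∑ i, (l i + ρ s i) / (p : ℤ) ^ s := by
  have h := fun i => padicValRat_bracket hD (hvm i) (hv i) (fun s hs => hρ s hs i)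
    (fun s hs => hρ' s hs i) (hl i) (hm i) (hb i)
  refine ⟨prod_ne_zero_iff.2 fun i _ => (h i).1, ?_⟩
  rw [vbracket, padicValRat_prod _ fun i _ => (h i).1, sum_congr rfl fun i _ => (h i).2,
    sum_neg_distrib, sum_comm]

theorem isPIntegral_iff {p : ℕ} [Fact p.Prime] {x : ℚ} (hx : x ≠ 0) :
    IsPIntegral p x ↔ 0 ≤ padicValRat p x := by
  rw [IsPIntegral, ← Rat.padicValuation_le_one_iff (p := p)]
  simp only [Rat.padicValuation, Valuation.coe_mk, MonoidWithZeroHom.coe_mk, ZeroHom.coe_mk,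
    if_neg hx]
  rw [← WithZero.exp_zero, WithZero.exp_le_exp, neg_nonpos]

end AHypergeometric

/-! ### Transfer between primes -/

namespace AHypergeometric

open Finset Filter

/-- `m' / D` is the representative in `[0, 1]` of the class of `(m / D) / P` modulo `1` (for
fractions of denominator prime to `P`), normalized so that it vanishes, or equals `1`, exactly if
`m / D` does. For given `m` and `D` it depends only on the residue of `P` modulo `D`. -/
structure IsDivisionResidue (D P m m' : ℤ) : Prop where
  dvd : D ∣ P * m' - m
  nonneg : 0 ≤ m'
  le : m' ≤ D
  eq_zero_iff : m' = 0 ↔ m = 0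
  eq_iff : m' = D ↔ m = D

theorem exists_isDivisionResidue {D P m : ℤ} (hD : 0 < D) (hP : IsCoprime P D)
    (hm : 0 ≤ m ∧ m ≤ D) : ∃ m', IsDivisionResidue D P m m' := by
  by_cases h0 : m = 0
  · exact ⟨0, by simp [h0], le_rfl, hD.le, by simp [h0], by simp [h0]⟩
  by_cases h1 : m = D
  · exact ⟨D, ⟨P - 1, by rw [h1]; ring⟩, hD.le, le_rfl, by simp [h1], by simp [h1]⟩
  obtain ⟨x, y, hxy⟩ := hP
  have h2 := Int.emod_nonneg (m * x) hD.ne'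
  have h3 := Int.emod_lt_of_pos (m * x) hD
  have h4 := Int.emod_add_mul_ediv (m * x) D
  have hdvd : D ∣ P * (m * x % D) - m :=
    ⟨-(P * (m * x / D) + y * m), by linear_combination P * h4 + m * hxy⟩
  refine ⟨m * x % D, hdvd, h2, h3.le, ⟨fun h => (h0 ?_).elim, fun h => (h0 h).elim⟩,
    ⟨fun h => (h3.ne h).elim, fun h => (h1 h).elim⟩⟩
  rw [h, mul_zero, zero_sub, dvd_neg] at hdvd
  exact Int.eq_zero_of_dvd_of_nonneg_of_lt hm.1 (hm.2.lt_of_ne h1) hdvd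

namespace IsDivisionResidue

variable {D P m m' : ℤ}

theorem congr {q : ℤ} (h : IsDivisionResidue D P m m') (hq : D ∣ q - P) :
    IsDivisionResidue D q m m' where
  __ := h
  dvd := by
    obtain ⟨x, hx⟩ := hq
    obtain ⟨y, hy⟩ := h.dvd
    exact ⟨x * m' + y, by linear_combination m' * hx + hy⟩

/-- The quotient `(P m' - m) / D` is the residue of `-m / D` modulo `P`. -/
theorem exists_residue (h : IsDivisionResidue D P m m') (hD : 0 < D) (hP : 0 < P)
    (hm : 0 ≤ m ∧ m ≤ D) : ∃ ρ, D * ρ = P * m' - m ∧ 0 ≤ ρ ∧ ρ < P := by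
  obtain ⟨ρ, hρ⟩ := h.dvd
  refine ⟨ρ, hρ.symm, ?_⟩
  rcases h.nonneg.eq_or_lt' with h0 | h0
  · have hm0 := h.eq_zero_iff.1 h0
    rw [h0, hm0, mul_zero, sub_zero, eq_comm, mul_eq_zero] at hρ
    have := hρ.resolve_left hD.ne'
    omega
  · have hm0 : 0 < m := hm.1.lt_of_ne' fun hm0 => h0.ne' (h.eq_zero_iff.2 hm0)
    have h1 : -D < D * ρ ∨ m = D := by
      rcases hm.2.lt_or_eq with h2 | h2
      · left
        nlinarith
      · exact Or.inr h2
    constructor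
    · rcases h1 with h1 | h1
      · by_contra! hneg
        nlinarith
      · rw [h.eq_iff.2 h1, h1] at hρ
        have : P - 1 = ρ := mul_left_cancel₀ hD.ne' (by linear_combination hρ)
        omega
    · have h2 := mul_le_mul_of_nonneg_left h.le hP.le
      by_contra! hge
      nlinarith

end IsDivisionResidue

/-- Passing from the modulus `P` and the vector `l` to a large modulus `q ≡ P` modulo `D` and
the multiple of `l` by `k = ⌈q / P⌉` does not change the floors in Legendre's formula. -/
theorem ediv_eq_of_large {D P q m m' ρ ρ' l k : ℤ} (hD : 0 < D) (hP : 0 < P)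
    (hm : 0 ≤ m ∧ m ≤ D) (hρ : D * ρ = P * m' - m) (hρ' : D * ρ' = q * m' - m)
    (hl : (m = 0 → 0 ≤ l) ∧ (m = D → l ≤ 0)) (hk : q ≤ P * k ∧ P * k < q + P)
    (hq : D * (|l| + 1) * P ≤ q) : (k * l + ρ') / q = (l + ρ) / P := by
  have hl0 := abs_nonneg l
  have hDl : 0 ≤ D * |l| := mul_nonneg hD.le hl0
  have hDP : 0 < D * P := mul_pos hD hP
  have hDlP : 0 ≤ D * |l| * P := mul_nonneg hDl hP.le
  have hq0 : 0 < q := by nlinarith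
  have hPq : P + D * |l| * P ≤ q := by nlinarith
  set f := (l + ρ) / P with hf
  obtain ⟨hf1, hf2⟩ := (Int.ediv_eq_iff_of_pos hP).1 hf.symm
  set δ := P * k - q with hδ
  have hδ0 : 0 ≤ δ := by omega
  have hδP : δ < P := by omega
  have hlδ : |D * l * δ| ≤ D * |l| * P := by
    rw [abs_mul, abs_mul, abs_of_pos hD, abs_of_nonneg hδ0]
    exact mul_le_mul_of_nonneg_left hδP.le hDl
  obtain ⟨hlδ1, hlδ2⟩ := abs_le.1 hlδ
  have hid : D * P * (k * l + ρ') = q * D * (l + ρ) + (D * l * δ + m * (q - P)) := by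
    rw [hδ]
    linear_combination P * hρ' - q * hρ
  -- the correction terms stay within the gap between `l + ρ` and the next multiples of `P`
  have hlow : 0 ≤ D * l * δ + m * (q - P) := by
    rcases hm.1.eq_or_lt' with h0 | h0
    · rw [h0, zero_mul, add_zero]
      exact mul_nonneg (mul_nonneg hD.le (hl.1 h0)) hδ0
    · have : q - P ≤ m * (q - P) := le_mul_of_one_le_left (by linarith) h0
      linarith
  have hupp : D * l * δ + m * (q - P) < q * D := by
    rcases hm.2.eq_or_lt with h1 | h1
    · have : D * l * δ ≤ 0 := mul_nonpos_of_nonpos_of_nonneg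
        (mul_nonpos_of_nonneg_of_nonpos hD.le (hl.2 h1)) hδ0
      rw [h1]
      nlinarith
    · have : m * (q - P) ≤ (D - 1) * (q - P) :=
        mul_le_mul_of_nonneg_right (by omega) (by linarith)
      nlinarith
  have hqD : 0 < q * D := mul_pos hq0 hD
  rw [Int.ediv_eq_iff_of_pos hq0]
  constructor
  · refine le_of_mul_le_mul_left ?_ hDP
    rw [hid]
    have := mul_le_mul_of_nonneg_left hf1 hqD.le
    linarith
  · refine lt_of_mul_lt_mul_left ?_ hDP.le
    rw [hid]
    have := mul_le_mul_of_nonneg_left (Int.add_one_le_iff.2 hf2) hqD.le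
    linarith

/-- The terms of Legendre's formula at the higher powers `Q` of a large prime `q` vanish. -/
theorem ediv_eq_zero_of_large {D q Q m m' ρ l k : ℤ} (hD : 0 < D)
    (hm : 0 ≤ m ∧ m ≤ D) (hρ : D * ρ = Q * m' - m) (h : IsDivisionResidue D Q m m')
    (hl : (m = 0 → 0 ≤ l) ∧ (m = D → l ≤ 0)) (hk : 0 ≤ k ∧ k ≤ q)
    (hq : D * (|l| + 1) ≤ q) (hQ : q * q ≤ Q) : (k * l + ρ) / Q = 0 := by
  have hl0 := abs_nonneg l
  have hq0 : 0 < q := by nlinarith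
  have hQ0 : 0 < Q := by nlinarith
  have hkl : |k * l| ≤ q * |l| := by
    rw [abs_mul, abs_of_nonneg hk.1]
    exact mul_le_mul_of_nonneg_right hk.2 hl0
  obtain ⟨hkl1, hkl2⟩ := abs_le.1 hkl
  -- `D k |l| + D ≤ Q`
  have hbound : D * (q * |l|) + D ≤ Q := by
    have h1 := mul_le_mul_of_nonneg_left hq hq0.le
    nlinarith
  have hDkl1 := mul_le_mul_of_nonneg_left hkl1 hD.le
  have hDkl2 := mul_le_mul_of_nonneg_left hkl2 hD.le
  refine Int.ediv_eq_zero_of_lt ?_ ?_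
  · refine nonneg_of_mul_nonneg_right (a := D) ?_ hD
    rw [mul_add, hρ]
    rcases h.nonneg.eq_or_lt' with h0 | h0
    · have hm0 := h.eq_zero_iff.1 h0
      have := mul_nonneg hD.le (mul_nonneg hk.1 (hl.1 hm0))
      rw [h0, hm0]
      linarith
    · have := le_mul_of_one_le_right hQ0.le (Int.add_one_le_iff.2 h0)
      linarith [hm.2]
  · refine lt_of_mul_lt_mul_left ?_ hD.le
    rw [mul_add, hρ]
    rcases h.le.eq_or_lt with h1 | h1
    · have hm1 := h.eq_iff.1 h1
      have : D * (k * l) ≤ 0 := mul_nonpos_of_nonneg_of_nonpos hD.le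
        (mul_nonpos_of_nonneg_of_nonpos hk.1 (hl.2 hm1))
      rw [h1, hm1]
      linarith
    · have := mul_le_mul_of_nonneg_left (Int.le_sub_one_of_lt h1) hQ0.le
      linarith [hm.1]

/-- Rational numbers in `[-1, 0]` with denominators prime to `p` have a common denominator prime
to `p`. -/
theorem exists_common_denominator {N p : ℕ} (hp : p.Prime) {v : Fin N → ℚ}
    (hv : ∀ i, -1 ≤ v i ∧ v i ≤ 0) (hvp : ∀ i, IsPIntegral p (v i)) :
    ∃ (D : ℕ) (m : Fin N → ℤ), ¬ p ∣ D ∧ (∀ i, v i = -m i / D) ∧ ∀ i, 0 ≤ m i ∧ m i ≤ D := by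
  have hpD : ¬ p ∣ ∏ i, (v i).den := fun h => by
    obtain ⟨i, -, hi⟩ := (Prime.dvd_finsetProd_iff hp.prime _).1 h
    exact hvp i hi
  set D := ∏ i, (v i).den with hD
  have hD0 : (0 : ℚ) < D := by
    rw [Nat.cast_pos]
    exact Finset.prod_pos fun i _ => (v i).den_pos
  have hm : ∀ i, ∃ m : ℤ, v i = -m / D := fun i => by
    obtain ⟨c, hc⟩ : (v i).den ∣ D := Finset.dvd_prod_of_mem _ (Finset.mem_univ i)
    refine ⟨-((v i).num * c), ?_⟩
    rw [eq_div_iff hD0.ne', hc, Nat.cast_mul, ← mul_assoc, Rat.mul_den_eq_num]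
    push_cast
    ring
  choose m hm using hm
  refine ⟨D, m, hpD, hm, fun i => ?_⟩
  obtain ⟨h1, h0⟩ := hv i
  rw [hm i, div_le_iff₀ hD0] at h0
  rw [hm i, le_div_iff₀ hD0] at h1
  constructor
  · have : (0 : ℚ) ≤ m i := by linarith
    exact_mod_cast this
  · have : (m i : ℚ) ≤ D := by linarith
    exact_mod_cast this

theorem exists_lt_pow {N p : ℕ} (hp : p.Prime) (D : ℕ) (l : Fin N → ℤ) :
    ∃ b, 2 ≤ b ∧ ∀ i, D * (|l i| + 1) < (p : ℤ) ^ b := by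
  refine ⟨(∑ i, D * ((l i).natAbs + 1)) + 2, by omega, fun i => ?_⟩
  have h1 : D * ((l i).natAbs + 1) ≤ ∑ i, D * ((l i).natAbs + 1) :=
    Finset.single_le_sum (f := fun i => D * ((l i).natAbs + 1)) (fun _ _ => Nat.zero_le _)
      (Finset.mem_univ i)
  have h2 := Nat.lt_pow_self hp.one_lt (n := (∑ i, D * ((l i).natAbs + 1)) + 2)
  have h3 : D * ((l i).natAbs + 1) < p ^ ((∑ i, D * ((l i).natAbs + 1)) + 2) := by omega
  rw [Int.abs_eq_natAbs]
  exact_mod_cast h3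

/-- If `[v]_l` is not `p`-integral, then there are arbitrarily large primes `q` for which some
multiple `k l` of `l` has a coefficient `[v]_{k l}` that is not `q`-integral. -/
theorem exists_not_isPIntegral {N p : ℕ} (hp : p.Prime) {v : Fin N → ℚ}
    (hv : ∀ i, -1 ≤ v i ∧ v i ≤ 0) (hvp : ∀ i, IsPIntegral p (v i)) {l : Fin N → ℤ}
    (hl : ∀ i, (v i = 0 → 0 ≤ l i) ∧ (v i = -1 → l i ≤ 0))
    (h : ¬ IsPIntegral p (vbracket v l)) (B : ℕ) :
    ∃ q > B, q.Prime ∧ ∃ k : ℕ, ¬ IsPIntegral q (vbracket v fun i => k * l i) := by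
  obtain ⟨D, m, hpD, hvm, hm⟩ := exists_common_denominator hp hv hvp
  have hD0 : D ≠ 0 := fun h0 => hpD (h0 ▸ dvd_zero p)
  have hDpos : 0 < (D : ℤ) := by exact_mod_cast Nat.pos_of_ne_zero hD0
  have hDQ : (D : ℚ) ≠ 0 := Nat.cast_ne_zero.2 hD0
  have hlm : ∀ i, (m i = 0 → 0 ≤ l i) ∧ (m i = D → l i ≤ 0) := fun i =>
    ⟨fun h0 => (hl i).1 (by rw [hvm, h0]; simp),
      fun h1 => (hl i).2 (by rw [hvm, h1, Int.cast_natCast, neg_div, div_self hDQ])⟩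
  have hcop : p.Coprime D := (Nat.Prime.coprime_iff_not_dvd hp).2 hpD
  have hres : ∀ {q : ℕ}, q.Coprime D → ∀ (s : ℕ) i,
      ∃ m', IsDivisionResidue D ((q : ℤ) ^ s) (m i) m' := fun hq s i =>
    exists_isDivisionResidue hDpos (Nat.isCoprime_iff_coprime.2 hq).pow_left (hm i)
  -- Legendre's formula at `p` provides a power `P` of `p` with a positive sum of floors
  have hFp : Fact p.Prime := ⟨hp⟩
  obtain ⟨b, -, hb⟩ := exists_lt_pow hp D l
  choose m' hm' using hres hcop
  choose ρ hρ hρ0 hρP using fun s i => (hm' s i).exists_residue hDpos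
    (pow_pos (by exact_mod_cast hp.pos) s) (hm i)
  obtain ⟨hne, hval⟩ := padicValRat_vbracket (b := b) hpD hv hvm hm
    (fun s _ i => ⟨m' s i, by rw [hρ, sub_add_cancel]⟩) (fun s _ i => ⟨hρ0 s i, hρP s i⟩) hl hb
  rw [isPIntegral_iff hne, hval, neg_nonneg, not_le] at h
  obtain ⟨s, -, hs⟩ := Finset.exists_lt_of_sum_lt (s := Ico 1 b) (f := fun _ => (0 : ℤ))
    (g := fun s => ∑ i, (l i + ρ s i) / (p : ℤ) ^ s) (by simpa using mod_cast h)
  set P : ℕ := p ^ s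
  have hPpos : 0 < P := pow_pos hp.pos s
  -- Dirichlet's theorem provides a large prime `q` congruent to `P` modulo `D`
  obtain ⟨q, hqB, hq, hqP⟩ := Nat.forall_exists_prime_gt_and_modEq
    (B + D + ∑ i, D * ((l i).natAbs + 1) * P) hD0 (Nat.Coprime.pow_left s hcop)
  have hqD : ¬ q ∣ D := fun hd => by
    have := Nat.le_of_dvd (Nat.pos_of_ne_zero hD0) hd
    omega
  have hqcop : q.Coprime D := (Nat.Prime.coprime_iff_not_dvd hq).2 hqD
  have hql : ∀ i, D * (|l i| + 1) * P ≤ (q : ℤ) := fun i => by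
    have h1 : D * ((l i).natAbs + 1) * P ≤ ∑ i, D * ((l i).natAbs + 1) * P :=
      Finset.single_le_sum (f := fun i => D * ((l i).natAbs + 1) * P) (fun _ _ => Nat.zero_le _)
        (Finset.mem_univ i)
    have h2 : D * ((l i).natAbs + 1) * P ≤ q := by omega
    rw [Int.abs_eq_natAbs]
    exact_mod_cast h2
  obtain ⟨k, hk1, hk2⟩ : ∃ k : ℕ, q ≤ P * k ∧ P * k < q + P := by
    refine ⟨(q + (P - 1)) / P, ?_, ?_⟩
    · have := Nat.lt_mul_div_succ (q + (P - 1)) hPpos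
      rw [mul_add, mul_one] at this
      omega
    · have := Nat.mul_div_le (q + (P - 1)) P
      omega
  have hkq : k ≤ q := by
    by_contra! hlt
    have h1 : P * (q + 1) ≤ P * k := Nat.mul_le_mul_left P hlt
    have h2 : q ≤ P * q := Nat.le_mul_of_pos_left q hPpos
    rw [mul_add] at h1
    omega
  have hqdvd : (D : ℤ) ∣ (q : ℤ) - (p : ℤ) ^ s := by
    have := (Nat.modEq_iff_dvd.1 hqP.symm)
    rwa [Nat.cast_pow] at this
  have hkl : ∀ i, (v i = 0 → 0 ≤ (k : ℤ) * l i) ∧ (v i = -1 → (k : ℤ) * l i ≤ 0) := fun i =>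
    ⟨fun h0 => mul_nonneg (Int.natCast_nonneg k) ((hl i).1 h0),
      fun h1 => mul_nonpos_of_nonneg_of_nonpos (Int.natCast_nonneg k) ((hl i).2 h1)⟩
  refine ⟨q, by omega, hq, k, ?_⟩
  -- Legendre's formula at `q` has the same sum of floors for `q` and vanishing ones beyond
  have hFq : Fact q.Prime := ⟨hq⟩
  have hqpos : 0 < (q : ℤ) := by exact_mod_cast hq.pos
  obtain ⟨c, hc2, hc⟩ := exists_lt_pow hq D fun i => k * l i
  have hσ : ∀ t ∈ Ico 1 c, ∀ i, ∃ σ : ℤ, (q : ℤ) ^ t ∣ D * σ + m i ∧ 0 ≤ σ ∧ σ < (q : ℤ) ^ t ∧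
      (k * l i + σ) / (q : ℤ) ^ t = if t = 1 then (l i + ρ s i) / (p : ℤ) ^ s else 0 := by
    intro t ht i
    rw [mem_Ico] at ht
    split_ifs with h1
    · rw [h1, pow_one]
      have hr := (hm' s i).congr hqdvd
      obtain ⟨σ, hσ, hσ0, hσq⟩ := hr.exists_residue hDpos hqpos (hm i)
      refine ⟨σ, ⟨m' s i, by rw [hσ, sub_add_cancel]⟩, hσ0, hσq, ?_⟩
      refine ediv_eq_of_large hDpos (by exact_mod_cast hPpos) (hm i) (hρ s i) hσ (hlm i)
        ⟨by exact_mod_cast hk1, by exact_mod_cast hk2⟩ (by exact_mod_cast hql i)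
    · obtain ⟨m'', hr⟩ := hres hqcop t i
      obtain ⟨σ, hσ, hσ0, hσq⟩ := hr.exists_residue hDpos (pow_pos hqpos t) (hm i)
      refine ⟨σ, ⟨m'', by rw [hσ, sub_add_cancel]⟩, hσ0, hσq, ?_⟩
      refine ediv_eq_zero_of_large hDpos (hm i) hσ hr (hlm i)
        ⟨Int.natCast_nonneg k, by exact_mod_cast hkq⟩ (le_trans ?_ (hql i)) ?_
      · exact le_mul_of_one_le_right (by positivity) (by exact_mod_cast hPpos)
      · rw [← sq]
        exact pow_le_pow_right₀ (by exact_mod_cast hq.one_le) (by omega)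
  choose! σ hσdvd hσ0 hσq hσ using hσ
  obtain ⟨hne', hval'⟩ := padicValRat_vbracket (b := c) hqD hv hvm hm hσdvd
    (fun t ht i => ⟨hσ0 t ht i, hσq t ht i⟩) hkl hc
  rw [isPIntegral_iff hne', hval', neg_nonneg, not_le]
  have hsum : ∑ t ∈ Ico 1 c, ∑ i, (k * l i + σ t i) / (q : ℤ) ^ t
      = ∑ i, (l i + ρ s i) / (p : ℤ) ^ s := by
    rw [Finset.sum_eq_single_of_mem 1 (mem_Ico.2 ⟨le_rfl, by omega⟩)]
    · exact sum_congr rfl fun i _ => by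
        rw [hσ 1 (mem_Ico.2 ⟨le_rfl, by omega⟩) i, if_pos rfl]
    · exact fun t ht h1 => sum_eq_zero fun i _ => by rw [hσ t ht i, if_neg h1]
  rw [hsum]
  exact_mod_cast hs

end AHypergeometric

theorem proposition7p5 {n N : ℕ} (a : Fin N → Fin n → ℤ) (v : Fin N → ℚ)
    (hv : ∀ i, -1 ≤ v i ∧ v i ≤ 0)
    (halg : (AHypergeometric.Phi a v).IsAlgebraicOverRatFunc)
    (hcone : AHypergeometric.LiesInPointedCone (AHypergeometric.Lv a v))
    (p : ℕ) (hp : p.Prime) (hvp : ∀ i, AHypergeometric.IsPIntegral p (v i)) :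
    (AHypergeometric.Phi a v).HasPIntegralCoeffs p := by
  intro w
  by_cases hw : AHypergeometric.Phi a v w = 0
  · simpa [AHypergeometric.IsPIntegral, hw] using hp.ne_one
  obtain ⟨l, hl, rfl⟩ := AHypergeometric.exists_of_Phi_ne_zero hw
  rw [AHypergeometric.Phi_shift hl]
  by_contra hint
  obtain ⟨B, hB⟩ := Filter.eventually_atTop.1
    (AHypergeometric.eventually_Phi_hasPIntegralCoeffs hv hcone halg)
  obtain ⟨q, hqB, hq, k, hk⟩ := AHypergeometric.exists_not_isPIntegral hp hv hvp
    ((AHypergeometric.mem_Lv_iff hv).1 hl).2 hint B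
  refine hk ?_
  rw [← AHypergeometric.Phi_shift (AHypergeometric.nsmul_mem_Lv hv hl k)]
  exact hB q hqB.le hq _
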